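/- Let $F(t)={}_2F_1\!\left(\tfrac12,\tfrac12;1;16t\right)=\sum_{k\ge0}\frac{(1/2)_k(1/2)_k}{(1)_k\,k!}(16t)^k=\sum_{k\ge 0}\binom{2k}{k}^2t^k$, regarded as a formal power series. For integers $n\ge1$ and $m\ge0$ define integers $B_n(m)$ and $C_n(m)$ by the identities of formal power series $$(1-16t)^{\lfloor \frac{n-1}{2}\rfloor}\,t^{2n-1}F(t)^{6n-1}=\sum_{m=0}^\infty B_n(m)t^m,\qquad (1-16t)^{\lfloor \frac{n-1}{2}\rfloor}\,t^{2n-2}F(t)^{6n-3}=\sum_{m=0}^\infty C_n(m)t^m.$$ Let $n\ge1$ be an integer and let $p>2$ be a prime. If $p\equiv(-1)^{n+1}\pmod 4$, then $B_n(p-1)\equiv0\pmod p$. If $p\equiv(-1)^{n}\pmod 4$, then $C_n(p-1)\equiv0\pmod p$. -/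

import Mathlib

namespace HypergeometricCongruence

noncomputable section

open PowerSeries

/-- The Gauss hypergeometric series `₂F₁(a, b; c; t) = ∑ (a)ₖ (b)ₖ / ((c)ₖ k!) tᵏ`
as a formal power series with rational coefficients. -/
def gauss (a b c : ℚ) : ℚ⟦X⟧ :=
  PowerSeries.mk fun k => ordinaryHypergeometricCoefficient a b c k

/-- The formal power series `F(t) = ₂F₁(1/2, 1/2; 1; 16 t)`. -/
def F : ℚ⟦X⟧ := PowerSeries.rescale (16 : ℚ) (gauss (1 / 2) (1 / 2) 1)

/-- `B n m` is the coefficient of `tᵐ` in `(1 - 16 t)^⌊(n-1)/2⌋ t^(2n-1) F^(6n-1)`, for `n ≥ 1`. -/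
def B (n m : ℕ) : ℚ :=
  PowerSeries.coeff m
    ((1 - PowerSeries.C (16 : ℚ) * X) ^ ((n - 1) / 2) * X ^ (2 * n - 1) * F ^ (6 * n - 1))

/-- `C n m` is the coefficient of `tᵐ` in `(1 - 16 t)^⌊(n-1)/2⌋ t^(2n-2) F^(6n-3)`, for `n ≥ 1`. -/
def C (n m : ℕ) : ℚ :=
  PowerSeries.coeff m
    ((1 - PowerSeries.C (16 : ℚ) * X) ^ ((n - 1) / 2) * X ^ (2 * n - 2) * F ^ (6 * n - 3))

end

end HypergeometricCongruence

/-!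
The coefficients `(2k choose k)²` of `F` are integers, so everything takes place in `ℤ⟦X⟧`.
Two observations give the theorem.

*Change of variable.* If `t(u) = u + ⋯` is an integral power series and `g(t) dt` an integral
differential, then the coefficients of index `p - 1` of `g` and of `g(t(u)) t'(u)` agree modulo `p`
(`coeff_subst_mul_derivative_modEq`). Indeed `tᵐ t' = (tᵐ⁺¹)' / (m + 1)` has its coefficient of
index `p - 1` divisible by `p` for `m + 1 < p`; this is the invariance of the Cartier operator
under change of parameter.

*A quartic transformation.* The Landen transformation `F(w / (1 + 4w)²) = (1 + 4w) F(w²)`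
(`landen`), applied twice, gives `F(t) = (1 + 2u)² F(u⁴)` for `t = u (1 + 4u²) / (1 + 2u)⁴`
(`quartic_transformation`). In the language of theta functions, `F(t) = θ₃(q)²`,
`2u = θ₂(q⁴) / θ₃(q⁴)`, and this is the decomposition `θ₃(q) = θ₃(q⁴) + θ₂(q⁴)`.
Under this substitution `1 - 16t = ((1 - 2u) / (1 + 2u))⁴` and `dt/du = (1 - 2u)³ / (1 + 2u)⁵`.
For both families the exponents match up so that the pulled back differential is, with `ε = ±1`,
`uᵃ (1 + 4u²)ᵃ (1 - 4u²)²ⁿ⁻¹ (1 + 4εu + 4u²) F(u⁴)ᵏ du`,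
where `a` is `2n - 1` or `2n - 2` (`pullback_eq`, `exists_sign_linear_factors`).
Since `(1 + 4u²)(1 - 4u²) = 1 - 16u⁴`, this is `uᵃ` times a series in `u⁴` times
`1 + 4εu + 4u²`, respectively `(1 - 4u²)(1 + 4εu + 4u²) = (1 - 16u⁴) + 4εu - 16εu³`.
The exponent `3`, respectively `2`, modulo `4` is missing in the last factor, and the hypothesis on
`p` modulo `4` says precisely that `p - 1 - a` lies in the missing class.
-/

namespace HypergeometricCongruence

open PowerSeries

/-! ### The integral model and its differential equation -/

/-- The integral model `∑ (2k choose k)² tᵏ` of the series `F`. -/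
noncomputable def centralBinomSqSeries : ℤ⟦X⟧ := PowerSeries.mk fun k => (k.centralBinom : ℤ) ^ 2

theorem coeff_succ_centralBinomSqSeries (k : ℕ) :
    ((k : ℤ) + 1) ^ 2 * coeff (k + 1) centralBinomSqSeries =
      4 * (2 * k + 1) ^ 2 * coeff k centralBinomSqSeries := by
  have h : ((k : ℤ) + 1) * (k + 1).centralBinom = 2 * (2 * k + 1) * k.centralBinom := by
    exact_mod_cast k.succ_mul_centralBinom_succ
  simp only [centralBinomSqSeries, coeff_mk]
  linear_combination (((k : ℤ) + 1) * (k + 1).centralBinom + 2 * (2 * k + 1) * k.centralBinom) * h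

theorem coeff_ofNat_mul (a n : ℕ) [a.AtLeastTwo] (f : ℤ⟦X⟧) :
    coeff n ((ofNat(a) : ℤ⟦X⟧) * f) = ofNat(a) * coeff n f := by
  rw [← map_ofNat (PowerSeries.C (R := ℤ)) a, coeff_C_mul]

/-- The hypergeometric equation `t(1 - 16t) F'' + (1 - 32t) F' - 4F = 0`. -/
theorem centralBinomSqSeries_ode :
    (X - 16 * X ^ 2) * d⁄dX ℤ (d⁄dX ℤ centralBinomSqSeries)
      + (1 - 32 * X) * d⁄dX ℤ centralBinomSqSeries - 4 * centralBinomSqSeries = 0 := by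
  ext k
  have h := coeff_succ_centralBinomSqSeries k
  rcases k with _ | _ | k <;>
  simp [sub_mul, pow_two, mul_assoc, coeff_ofNat_mul, coeff_succ_X_mul, coeff_zero_X_mul,
    coeff_derivative, -coeff_zero_eq_constantCoeff] at h ⊢ <;> linear_combination h

/-- The hypergeometric equation in the variable `w²`, read off on coefficients: it determines a
solution from its constant coefficient. -/
theorem coeff_of_ode {G : ℤ⟦X⟧}
    (hG : X * (1 - 16 * X ^ 2) * d⁄dX ℤ (d⁄dX ℤ G) + (1 - 48 * X ^ 2) * d⁄dX ℤ G
      - 16 * X * G = 0) :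
    coeff 1 G = 0 ∧
      ∀ n : ℕ, ((n : ℤ) + 2) ^ 2 * coeff (n + 2) G = 16 * (n + 1) ^ 2 * coeff n G := by
  have h (n : ℕ) := congrArg (coeff n) hG
  refine ⟨?_, fun n => ?_⟩
  · have := h 0
    simpa [sub_mul, mul_sub, pow_two, mul_assoc, coeff_ofNat_mul, coeff_zero_X_mul,
      coeff_derivative, -coeff_zero_eq_constantCoeff, mul_left_comm X] using this
  · have := h (n + 1)
    rcases n with _ | _ | n <;>
    simp [sub_mul, mul_sub, pow_two, mul_assoc, coeff_ofNat_mul, coeff_succ_X_mul,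
      coeff_zero_X_mul, coeff_derivative, -coeff_zero_eq_constantCoeff, mul_left_comm X]
      at this ⊢ <;> linear_combination this

/-! ### Landen's transformation and its iterate -/

theorem derivative_of_mul_eq_one {E W : ℤ⟦X⟧} (h : E * W = 1) :
    d⁄dX ℤ E = - (d⁄dX ℤ W) * E ^ 2 := by
  have := congrArg (d⁄dX ℤ) h
  simp at this
  linear_combination E * this - d⁄dX ℤ E * h

theorem derivative_ofNat (a : ℕ) [a.AtLeastTwo] : d⁄dX ℤ (ofNat(a) : ℤ⟦X⟧) = 0 := by
  rw [← map_ofNat (PowerSeries.C (R := ℤ)) a, derivative_C]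

/-- The series `(1 + 4w)⁻¹ F(w / (1 + 4w)²)` satisfies the differential equation of `F(w²)`. Here
and below a reciprocal is a series `E` with `E * (1 + 4 * X) = 1`, as `ℤ⟦X⟧` has no division. -/
theorem landen_ode {E : ℤ⟦X⟧} (hE : E * (1 + 4 * X) = 1) (G : ℤ⟦X⟧)
    (hG : G = E * centralBinomSqSeries.subst (X * E ^ 2)) :
    X * (1 - 16 * X ^ 2) * d⁄dX ℤ (d⁄dX ℤ G) + (1 - 48 * X ^ 2) * d⁄dX ℤ G
      - 16 * X * G = 0 := by
  have hs : HasSubst (X * E ^ 2) := HasSubst.of_constantCoeff_zero' (by simp)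
  have dE : d⁄dX ℤ E = -4 * E ^ 2 := by
    rw [derivative_of_mul_eq_one hE]; simp [derivative_ofNat]
  have dz : d⁄dX ℤ (X * E ^ 2) = (1 - 4 * X) * E ^ 3 := by
    simp [dE]
    linear_combination - E ^ 2 * hE
  have ode := congrArg (substAlgHom hs) centralBinomSqSeries_ode
  simp only [map_add, map_sub, map_mul, map_pow, substAlgHom_X, map_ofNat, map_one, map_zero,
    coe_substAlgHom] at ode
  have d0 := derivative_subst (f := centralBinomSqSeries) hs
  have d1 := derivative_subst (f := d⁄dX ℤ centralBinomSqSeries) hs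
  rw [dz] at d0 d1
  generalize centralBinomSqSeries.subst (X * E ^ 2) = g at *
  generalize (d⁄dX ℤ centralBinomSqSeries).subst (X * E ^ 2) = g₁ at *
  generalize (d⁄dX ℤ (d⁄dX ℤ centralBinomSqSeries)).subst (X * E ^ 2) = g₂ at *
  have dG : d⁄dX ℤ G = -4 * E ^ 2 * g + (1 - 4 * X) * E ^ 4 * g₁ := by
    rw [hG]
    simp [d0, dE]
    ring
  have ddG : d⁄dX ℤ (d⁄dX ℤ G) = 32 * E ^ 3 * g
      + (-20 * (1 - 4 * X) * E ^ 5 - 4 * E ^ 4) * g₁ + (1 - 4 * X) ^ 2 * E ^ 7 * g₂ := by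
    rw [dG]
    simp [d0, d1, dE, derivative_ofNat]
    ring
  rw [ddG, dG, hG]
  clear d0 d1 dG ddG dz dE hG
  -- The remaining identity is `(1 - 4x) E²` times `ode`, modulo the relation `E (1 + 4x) = 1`.
  generalize (X : ℤ⟦X⟧) = x at *
  grind

/-- Landen's transformation `(1 + 4w)⁻¹ F(w / (1 + 4w)²) = F(w²)`. -/
theorem landen {E : ℤ⟦X⟧} (hE : E * (1 + 4 * X) = 1) :
    E * centralBinomSqSeries.subst (X * E ^ 2) =
      expand 2 two_ne_zero centralBinomSqSeries := by
  obtain ⟨h1, hrec⟩ := coeff_of_ode (landen_ode hE _ rfl)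
  have hs : HasSubst (X * E ^ 2) := HasSubst.of_constantCoeff_zero' (by simp)
  have h0 : coeff 0 (E * centralBinomSqSeries.subst (X * E ^ 2)) = 1 := by
    have hE0 : constantCoeff E = 1 := by simpa using congrArg constantCoeff hE
    have : coeff 0 (centralBinomSqSeries.subst (X * E ^ 2)) = 1 := by
      rw [coeff_subst' hs, finsum_eq_single _ 0]
      · simp [centralBinomSqSeries]
      · intro n hn
        simp [hn]
    simpa [hE0] using this
  generalize E * centralBinomSqSeries.subst (X * E ^ 2) = G at *
  have key : ∀ k : ℕ, coeff (2 * k) G = coeff k centralBinomSqSeries ∧ coeff (2 * k + 1) G = 0 := by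
    intro k
    induction k with
    | zero => exact ⟨by simpa [centralBinomSqSeries] using h0, h1⟩
    | succ k ih =>
      have he := hrec (2 * k)
      have ho := hrec (2 * k + 1)
      rw [ih.1] at he
      rw [ih.2] at ho
      have hf := coeff_succ_centralBinomSqSeries k
      push_cast at he ho
      constructor
      · have : ((2 * k + 2 : ℤ)) ^ 2 ≠ 0 := by positivity
        apply mul_left_cancel₀ this
        rw [show 2 * (k + 1) = 2 * k + 2 by ring]
        linear_combination he - 4 * hf
      · have : ((2 * k + 1 + 2 : ℤ)) ^ 2 ≠ 0 := by positivity
        apply mul_left_cancel₀ this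
        rw [show 2 * (k + 1) + 1 = 2 * k + 1 + 2 by ring]
        linear_combination ho
  ext n
  obtain ⟨k, rfl | rfl⟩ := n.even_or_odd'
  · rw [(key k).1, coeff_expand_mul]
  · rw [(key k).2, coeff_expand_of_not_dvd _ _ _ (by omega)]

/-- Landen's transformation applied twice: `F(t) = (1 + 2u)² F(u⁴)` for
`t = u (1 + 4u²) / (1 + 2u)⁴`. -/
theorem quartic_transformation {V : ℤ⟦X⟧} (hV : V * (1 + 2 * X) = 1) :
    centralBinomSqSeries.subst (X * (1 + 4 * X ^ 2) * V ^ 4) =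
      (1 + 2 * X) ^ 2 * expand 4 four_ne_zero centralBinomSqSeries := by
  obtain ⟨E, hE⟩ : ∃ E : ℤ⟦X⟧, E * (1 + 4 * X) = 1 :=
    ⟨invOfUnit (1 + 4 * X) 1, invOfUnit_mul _ _ (by simp)⟩
  have hs : HasSubst (X * E ^ 2) := HasSubst.of_constantCoeff_zero' (by simp)
  set Q := expand 2 two_ne_zero E with hQdef
  have hQ : Q * (1 + 4 * X ^ 2) = 1 := by
    simpa only [map_add, map_mul, map_ofNat, map_one, expand_X] using
      congrArg (expand 2 two_ne_zero) hE
  have hw : HasSubst (X * Q) := HasSubst.of_constantCoeff_zero' (by simp)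
  set U := E.subst (X * Q) with hUdef
  have hU : U * (1 + 4 * (X * Q)) = 1 := by
    simpa only [map_add, map_mul, map_ofNat, map_one, substAlgHom_X, coe_substAlgHom] using
      congrArg (substAlgHom hw) hE
  -- With `w = u / (1 + 4u²)`, the argument `w²` is also the inner argument of Landen's
  -- transformation at `u²`, which links the two instances.
  have inner := congrArg (expand 2 two_ne_zero) (landen hE)
  rw [map_mul, expand_apply 2 _ (subst _ _),
    subst_comp_subst_apply hs (HasSubst.X_pow two_ne_zero), ← expand_apply 2 two_ne_zero,
    ← expand_mul] at inner
  have outer := congrArg (subst (X * Q)) (landen hE)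
  rw [subst_mul hw, subst_comp_subst_apply hs hw, subst_mul hw, subst_pow hw, subst_X hw,
    expand_apply, subst_comp_subst_apply (HasSubst.X_pow two_ne_zero) hw, subst_pow hw,
    subst_X hw] at outer
  have hUV : U = (1 + 4 * X ^ 2) * V ^ 2 := by
    grind
  rw [show expand 2 two_ne_zero (X * E ^ 2) = (X * Q) ^ 2 by simp [mul_pow, hQdef]] at inner
  rw [← hUdef, show X * Q * U ^ 2 = X * (1 + 4 * X ^ 2) * V ^ 4 by
    rw [hUV]; linear_combination (X * (1 + 4 * X ^ 2) * V ^ 4) * hQ] at outer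
  rw [← inner]
  generalize subst (X * (1 + 4 * X ^ 2) * V ^ 4) centralBinomSqSeries = a at *
  generalize subst ((X * Q) ^ 2) centralBinomSqSeries = b at *
  rw [← hQdef, ← outer, hUV]
  grind

/-! ### Change of variable modulo a prime -/

/-- The differential `tᵐ dt = d(tᵐ⁺¹) / (m + 1)` is exact over the integers localized at `p`. -/
theorem dvd_coeff_pow_mul_derivative {p m : ℕ} (hp : p.Prime) (hm : m + 1 < p) (t : ℤ⟦X⟧) :
    (p : ℤ) ∣ coeff (p - 1) (t ^ m * d⁄dX ℤ t) := by
  have h : ((m : ℤ) + 1) * coeff (p - 1) (t ^ m * d⁄dX ℤ t) = p * coeff p (t ^ (m + 1)) := by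
    have h := coeff_derivative (t ^ (m + 1)) (p - 1)
    rw [derivative_pow, Nat.sub_add_cancel hp.one_le, mul_assoc, ← Nat.cast_succ,
      Nat.succ_eq_add_one, Nat.sub_add_cancel hp.one_le, ← map_natCast (PowerSeries.C (R := ℤ)),
      coeff_C_mul] at h
    simp at h
    linear_combination h
  refine (IsCoprime.dvd_of_dvd_mul_left ?_ ⟨_, h⟩)
  have : p.Coprime (m + 1) := Nat.Coprime.symm (Nat.coprime_of_lt_prime m.succ_ne_zero hm hp).symm
  exact_mod_cast this.isCoprime

/-- Modulo `p`, the coefficient of index `p - 1` of a differential `g(t) dt` does not change when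
`t` is replaced by a power series `u + ⋯` in a new variable `u`. -/
theorem coeff_subst_mul_derivative_modEq {p : ℕ} (hp : p.Prime) (g s : ℤ⟦X⟧)
    (hs : constantCoeff s = 1) :
    coeff (p - 1) (g.subst (X * s) * d⁄dX ℤ (X * s)) ≡ coeff (p - 1) g [ZMOD p] := by
  set t := X * s with ht
  have hst : HasSubst t := HasSubst.of_constantCoeff_zero' (by simp [ht])
  obtain ⟨q, rfl⟩ : ∃ q, p = q + 1 := ⟨p - 1, (Nat.sub_add_cancel hp.one_le).symm⟩
  obtain ⟨r, hr⟩ : X ^ (q + 1) ∣ g - (trunc (q + 1) g : ℤ⟦X⟧) := by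
    rw [X_pow_dvd_iff]
    intro m hm
    simp [coeff_trunc, hm]
  have hg' := sub_eq_iff_eq_add'.1 hr
  have hg : g.subst t = ∑ m ∈ Finset.range (q + 1), coeff m g • t ^ m
      + X ^ (q + 1) * (s ^ (q + 1) * r.subst t) := by
    conv_lhs => rw [hg']
    rw [subst_add hst, subst_mul hst, subst_pow hst, subst_X hst,
      subst_coe hst, Polynomial.aeval_eq_sum_range' (natDegree_trunc_lt g q), ht, mul_pow,
      mul_assoc]
    congr 1
    refine Finset.sum_congr rfl fun m hm => ?_
    rw [coeff_trunc, if_pos (Finset.mem_range.1 hm)]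
    rfl
  have htop : coeff q (t ^ q * d⁄dX ℤ t) = 1 := by
    rw [ht, mul_pow, mul_assoc, coeff_X_pow_mul', if_pos le_rfl, Nat.sub_self]
    simp [hs]
  have htail : coeff q (X ^ (q + 1) * (s ^ (q + 1) * r.subst t) * d⁄dX ℤ t) = 0 := by
    rw [mul_assoc, coeff_X_pow_mul', if_neg (by omega)]
  rw [Nat.add_sub_cancel, hg, add_mul, map_add, htail, add_zero, Finset.sum_mul, map_sum,
    Finset.sum_range_succ, smul_mul_assoc, map_smul, htop, smul_eq_mul, mul_one]
  refine Int.ModEq.symm (Int.modEq_iff_dvd.2 ?_)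
  rw [add_sub_cancel_right]
  refine Finset.dvd_sum fun m hm => ?_
  rw [smul_mul_assoc, map_smul, smul_eq_mul]
  exact (dvd_coeff_pow_mul_derivative hp (by have := Finset.mem_range.1 hm; omega) t).mul_left _

/-! ### The pulled back differentials -/

/-- The differential `(1 - 16t)ᵉ tᵃ F(t)ᵏ dt` in the variable `u` of the quartic transformation.
The exponent `l` collects `2k` factors `1 + 2u` from `Fᵏ` and `4e + 4a + 5` factors of the
denominator; it is a natural number in the cases of interest. -/
theorem pullback_eq {V : ℤ⟦X⟧} (hV : V * (1 + 2 * X) = 1) {e a k l : ℕ}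
    (hl : 2 * k = 4 * e + 4 * a + 5 + l) :
    ((1 - 16 * X) ^ e * X ^ a * centralBinomSqSeries ^ k).subst (X * ((1 + 4 * X ^ 2) * V ^ 4))
        * d⁄dX ℤ (X * ((1 + 4 * X ^ 2) * V ^ 4)) =
      X ^ a * (1 + 4 * X ^ 2) ^ a * (1 - 2 * X) ^ (4 * e + 3) * (1 + 2 * X) ^ l *
        expand 4 four_ne_zero centralBinomSqSeries ^ k := by
  have hs : HasSubst (X * ((1 + 4 * X ^ 2) * V ^ 4)) :=
    HasSubst.of_constantCoeff_zero' (by simp)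
  have dV : d⁄dX ℤ V = -2 * V ^ 2 := by
    rw [derivative_of_mul_eq_one hV]; simp [derivative_ofNat]
  have dT : d⁄dX ℤ (X * ((1 + 4 * X ^ 2) * V ^ 4)) = (1 - 2 * X) ^ 3 * V ^ 5 := by
    simp [dV, derivative_ofNat]
    generalize (X : ℤ⟦X⟧) = x at *
    grind
  have h16 : 1 - 16 * (X * ((1 + 4 * X ^ 2) * V ^ 4)) = (1 - 2 * X) ^ 4 * V ^ 4 := by
    generalize (X : ℤ⟦X⟧) = x at *
    grind
  have hF := quartic_transformation hV
  rw [mul_assoc] at hF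
  rw [dT, ← coe_substAlgHom hs]
  simp only [map_sub, map_mul, map_pow, substAlgHom_X, map_ofNat, map_one]
  rw [coe_substAlgHom, hF, h16]
  have hVl : V ^ (4 * e + 4 * a + 5) * (1 + 2 * X) ^ (2 * k) = (1 + 2 * X) ^ l := by
    rw [hl, pow_add _ _ l, ← mul_assoc, ← mul_pow, hV, one_pow, one_mul]
  rw [← hVl]
  generalize expand 4 four_ne_zero centralBinomSqSeries = φ
  generalize (1 - 2 * X : ℤ⟦X⟧) = P, (1 + 2 * X : ℤ⟦X⟧) = R, (1 + 4 * X ^ 2 : ℤ⟦X⟧) = S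
  simp only [mul_pow, ← pow_mul, pow_add]
  ring

theorem coeff_X_pow_mul_expand_four (g : ℤ⟦X⟧) {b m : ℕ} (h : ¬ b ≡ m [MOD 4]) :
    coeff m (X ^ b * expand 4 four_ne_zero g) = 0 := by
  rw [coeff_X_pow_mul']
  split_ifs with hb
  · exact coeff_expand_of_not_dvd _ _ _ fun hd => h ((Nat.modEq_iff_dvd' hb).2 hd)
  · rfl

/-- The linear factors of the pulled back differential pair off, leaving the square of
`1 - 2u` for odd `n` and of `1 + 2u` for even `n`. -/
theorem exists_sign_linear_factors {n : ℕ} (hn : 1 ≤ n) :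
    ∃ (l : ℕ) (ε : ℤ), 4 * ((n - 1) / 2) + 3 + l = 4 * n ∧
      ((1 - 2 * X) ^ (4 * ((n - 1) / 2) + 3) * (1 + 2 * X) ^ l : ℤ⟦X⟧) =
        (1 - 4 * X ^ 2) ^ (2 * n - 1) * (1 + 4 * (ε : ℤ⟦X⟧) * X + 4 * X ^ 2) := by
  obtain ⟨j, rfl | rfl⟩ : ∃ j, n = 2 * j + 1 ∨ n = 2 * j + 2 := ⟨(n - 1) / 2, by omega⟩
  · refine ⟨4 * j + 1, -1, by omega, ?_⟩
    rw [show 4 * ((2 * j + 1 - 1) / 2) + 3 = (4 * j + 1) + 2 by omega,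
      show 2 * (2 * j + 1) - 1 = 4 * j + 1 by omega,
      show (1 - 4 * X ^ 2 : ℤ⟦X⟧) = (1 - 2 * X) * (1 + 2 * X) by ring, mul_pow, pow_add]
    push_cast
    ring
  · refine ⟨4 * j + 5, 1, by omega, ?_⟩
    rw [show 4 * ((2 * j + 2 - 1) / 2) + 3 = 4 * j + 3 by omega,
      show 4 * j + 5 = (4 * j + 3) + 2 by ring, show 2 * (2 * j + 2) - 1 = 4 * j + 3 by omega,
      show (1 - 4 * X ^ 2 : ℤ⟦X⟧) = (1 - 2 * X) * (1 + 2 * X) by ring, mul_pow, pow_add _ _ 2]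
    push_cast
    ring

/-- For both families `2k = 4a + 4n + 2`, which makes the exponents of `pullback_eq` those of
`exists_sign_linear_factors`. -/
theorem coeff_modEq_coeff_pullback {n p a k : ℕ} (hn : 1 ≤ n) (hp : p.Prime)
    (hk : k = 2 * a + 2 * n + 1) :
    ∃ ε : ℤ, coeff (p - 1) ((1 - 16 * X) ^ ((n - 1) / 2) * X ^ a * centralBinomSqSeries ^ k) ≡
      coeff (p - 1) (X ^ a * (1 + 4 * X ^ 2) ^ a *
        ((1 - 4 * X ^ 2) ^ (2 * n - 1) * (1 + 4 * (ε : ℤ⟦X⟧) * X + 4 * X ^ 2)) *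
        expand 4 four_ne_zero centralBinomSqSeries ^ k) [ZMOD p] := by
  obtain ⟨V, hV⟩ : ∃ V : ℤ⟦X⟧, V * (1 + 2 * X) = 1 :=
    ⟨invOfUnit (1 + 2 * X) 1, invOfUnit_mul _ _ (by simp)⟩
  have hV0 : constantCoeff V = 1 := by simpa using congrArg constantCoeff hV
  obtain ⟨l, ε, hl, hε⟩ := exists_sign_linear_factors hn
  refine ⟨ε, ?_⟩
  have h := coeff_subst_mul_derivative_modEq hp
    ((1 - 16 * X) ^ ((n - 1) / 2) * X ^ a * centralBinomSqSeries ^ k)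
    ((1 + 4 * X ^ 2) * V ^ 4) (by simp [hV0])
  rw [pullback_eq hV (l := l) (by omega), mul_assoc (X ^ a * _), hε] at h
  exact h.symm

/-- The congruence for the family `B`. -/
theorem dvd_coeff_pow_two_mul_sub_one {n p : ℕ} (hn : 1 ≤ n) (hp : p.Prime)
    (h : p % 4 = (2 * n + 3) % 4) :
    (p : ℤ) ∣ coeff (p - 1) ((1 - 16 * X) ^ ((n - 1) / 2) * X ^ (2 * n - 1) *
      centralBinomSqSeries ^ (6 * n - 1)) := by
  obtain ⟨ε, hε⟩ := coeff_modEq_coeff_pullback hn hp (a := 2 * n - 1) (k := 6 * n - 1) (by omega)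
  refine Int.modEq_zero_iff_dvd.1 (hε.trans (congrArg (· % (p : ℤ)) ?_))
  have hp1 := hp.one_le
  set ψ : ℤ⟦X⟧ := (1 - 16 * X) ^ (2 * n - 1) * centralBinomSqSeries ^ (6 * n - 1) with hψ
  have key : X ^ (2 * n - 1) * (1 + 4 * X ^ 2) ^ (2 * n - 1) *
        ((1 - 4 * X ^ 2) ^ (2 * n - 1) * (1 + 4 * (ε : ℤ⟦X⟧) * X + 4 * X ^ 2)) *
        expand 4 four_ne_zero centralBinomSqSeries ^ (6 * n - 1) =
      X ^ (2 * n - 1) * expand 4 four_ne_zero ψ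
        + X ^ (2 * n - 1 + 1) * expand 4 four_ne_zero (4 * (ε : ℤ⟦X⟧) * ψ)
        + X ^ (2 * n - 1 + 2) * expand 4 four_ne_zero (4 * ψ) := by
    simp only [hψ, map_mul, map_pow, map_sub, map_one, map_ofNat, map_intCast, expand_X]
    rw [show (1 - 16 * X ^ 4 : ℤ⟦X⟧) = (1 + 4 * X ^ 2) * (1 - 4 * X ^ 2) by ring, mul_pow]
    ring
  rw [key, map_add, map_add, coeff_X_pow_mul_expand_four, coeff_X_pow_mul_expand_four,
    coeff_X_pow_mul_expand_four, add_zero, add_zero] <;> (unfold Nat.ModEq; omega)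

/-- The congruence for the family `C`. -/
theorem dvd_coeff_pow_two_mul_sub_two {n p : ℕ} (hn : 1 ≤ n) (hp : p.Prime)
    (h : p % 4 = (2 * n + 1) % 4) :
    (p : ℤ) ∣ coeff (p - 1) ((1 - 16 * X) ^ ((n - 1) / 2) * X ^ (2 * n - 2) *
      centralBinomSqSeries ^ (6 * n - 3)) := by
  obtain ⟨ε, hε⟩ := coeff_modEq_coeff_pullback hn hp (a := 2 * n - 2) (k := 6 * n - 3) (by omega)
  refine Int.modEq_zero_iff_dvd.1 (hε.trans (congrArg (· % (p : ℤ)) ?_))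
  have hp1 := hp.one_le
  set ψ : ℤ⟦X⟧ := (1 - 16 * X) ^ (2 * n - 2) * centralBinomSqSeries ^ (6 * n - 3) with hψ
  have key : X ^ (2 * n - 2) * (1 + 4 * X ^ 2) ^ (2 * n - 2) *
        ((1 - 4 * X ^ 2) ^ (2 * n - 1) * (1 + 4 * (ε : ℤ⟦X⟧) * X + 4 * X ^ 2)) *
        expand 4 four_ne_zero centralBinomSqSeries ^ (6 * n - 3) =
      X ^ (2 * n - 2) * expand 4 four_ne_zero ((1 - 16 * X) * ψ)
        + X ^ (2 * n - 2 + 1) * expand 4 four_ne_zero (4 * (ε : ℤ⟦X⟧) * ψ)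
        + X ^ (2 * n - 2 + 3) * expand 4 four_ne_zero (-16 * (ε : ℤ⟦X⟧) * ψ) := by
    simp only [hψ, map_mul, map_pow, map_sub, map_neg, map_one, map_ofNat, map_intCast, expand_X]
    rw [show (1 - 16 * X ^ 4 : ℤ⟦X⟧) = (1 + 4 * X ^ 2) * (1 - 4 * X ^ 2) by ring, mul_pow,
      show 2 * n - 1 = (2 * n - 2) + 1 by omega]
    ring
  rw [key, map_add, map_add, coeff_X_pow_mul_expand_four, coeff_X_pow_mul_expand_four,
    coeff_X_pow_mul_expand_four, add_zero, add_zero] <;> (unfold Nat.ModEq; omega)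

/-! ### Comparison with the rational series -/

theorem map_centralBinomSqSeries : centralBinomSqSeries.map (Int.castRingHom ℚ) = F := by
  ext k
  have h : (4 : ℚ) ^ k * (ascPochhammer ℚ k).eval (1 / 2) = k.centralBinom * k.factorial := by
    induction k with
    | zero => simp
    | succ k ih =>
      have h : ((k : ℚ) + 1) * (k + 1).centralBinom = 2 * (2 * k + 1) * k.centralBinom := by
        exact_mod_cast k.succ_mul_centralBinom_succ
      rw [ascPochhammer_succ_eval, Nat.factorial_succ]
      push_cast
      linear_combination (4 * (1 / 2 + (k : ℚ))) * ih - k.factorial * h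
  have hk : (k.factorial : ℚ) ≠ 0 := by exact_mod_cast k.factorial_ne_zero
  simp only [F, gauss, coeff_rescale, coeff_mk, coeff_map, centralBinomSqSeries,
    ordinaryHypergeometricCoefficient, ascPochhammer_eval_one]
  rw [show (16 : ℚ) = 4 * 4 by norm_num, mul_pow]
  generalize (ascPochhammer ℚ k).eval (1 / 2) = c at *
  field_simp
  simp
  linear_combination (-(4 : ℚ) ^ k * c - k.centralBinom * k.factorial) * h

theorem coeff_rational_eq_intCast (e a k m : ℕ) :
    coeff m ((1 - PowerSeries.C (16 : ℚ) * X) ^ e * X ^ a * F ^ k) =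
      ((coeff m ((1 - 16 * X) ^ e * X ^ a * centralBinomSqSeries ^ k) : ℤ) : ℚ) := by
  rw [← map_centralBinomSqSeries, ← eq_intCast (Int.castRingHom ℚ), ← coeff_map]
  have h16 : (16 : ℤ⟦X⟧).map (Int.castRingHom ℚ) = PowerSeries.C 16 := by
    rw [map_ofNat, map_ofNat]
  simp only [map_mul, map_pow, map_sub, map_one, map_X, h16]

end HypergeometricCongruence

theorem corollary2 (n : ℕ) (hn : 1 ≤ n) (p : ℕ) (hp : p.Prime) (hp2 : 2 < p) :
    ((p : ℤ) ≡ (-1) ^ (n + 1) [ZMOD 4] →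
      ∃ b : ℤ, (b : ℚ) = HypergeometricCongruence.B n (p - 1) ∧ b ≡ 0 [ZMOD (p : ℤ)]) ∧
    ((p : ℤ) ≡ (-1) ^ n [ZMOD 4] →
      ∃ c : ℤ, (c : ℚ) = HypergeometricCongruence.C n (p - 1) ∧ c ≡ 0 [ZMOD (p : ℤ)]) := by
  have hpow : ((-1) ^ n : ℤ) ≡ 2 * n + 1 [ZMOD 4] := by
    obtain ⟨j, rfl | rfl⟩ := n.even_or_odd'
    · rw [pow_mul]
      norm_num [Int.ModEq]
      omega
    · rw [pow_succ, pow_mul]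
      norm_num [Int.ModEq]
      omega
  refine ⟨fun h => ⟨_, (HypergeometricCongruence.coeff_rational_eq_intCast _ _ _ _).symm,
      Int.modEq_zero_iff_dvd.2 (HypergeometricCongruence.dvd_coeff_pow_two_mul_sub_one hn hp ?_)⟩,
    fun h => ⟨_, (HypergeometricCongruence.coeff_rational_eq_intCast _ _ _ _).symm,
      Int.modEq_zero_iff_dvd.2 (HypergeometricCongruence.dvd_coeff_pow_two_mul_sub_two hn hp ?_)⟩⟩
  · rw [pow_succ] at h
    unfold Int.ModEq at h hpow
    omega
  · unfold Int.ModEq at h hpow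
    omega
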